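/- Let $X_1, X_2, \ldots$ be independent identically distributed real random variables, and write $X$ for a random variable with their common distribution. Let $K, m$ be positive integers and let $f_1, \ldots, f_m : \mathbb R \to \mathbb R$ be measurable functions such that $\mathbb E[f_i^4(X)] < \infty$ and $\mathrm{Var}(f_i(X)) > 0$ for every $i$. For $f, g : \mathbb R \to \mathbb R$ and a lag $k \ge 1$, define from the first $N > k$ terms $$\hat m(f) := \frac1N\sum_{i=1}^N f(X_i),\qquad \hat s(f) := \Bigl[\frac1N\sum_{i=1}^N \bigl(f(X_i) - \hat m(f)\bigr)^2\Bigr]^{1/2},$$ $$\hat\gamma_k(f, g) := \frac1{N-k}\sum_{i=1}^{N-k}\bigl(f(X_i) - \hat m(f)\bigr)\bigl(g(X_{i+k}) - \hat m(g)\bigr),\qquad \hat\rho_k(f, g) := \frac{\hat\gamma_k(f, g)}{\hat s(f)\,\hat s(g)},$$ where $\hat\rho_k(f,g) := 0$ if the denominator vanishes, and let $\hat{\mathbb C}_k := [\hat\rho_k(f_i, f_j),\ i, j = 1, \ldots, m] \in \mathbb R^{m^2}$ for $k = 1, \ldots, K$. Suppose that $\mathrm{Cov}(f_i(X), f_j(X))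 = 0$ for all $i, j = 1, \ldots, m$ with $i \ne j$. Then, as $N \to \infty$, $$N^{1/2}\bigl[\hat{\mathbb C}_1, \ldots, \hat{\mathbb C}_K\bigr] \Rightarrow N_{m^2K}(\mathbf 0, I_{m^2K}),$$ where $\Rightarrow$ denotes weak convergence of distributions on $\mathbb R^{m^2K}$ and $I_{m^2K}$ is the identity matrix. -/

import Mathlib

open MeasureTheory ProbabilityTheory Filter

/-! Empirical quantities of a real data sequence. The observations `X₁, X₂, …` are numbered
from zero here: `x i` stands for `X_{i+1}`, and the first `N` observations are
`x 0, …, x (N - 1)`. -/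

/-- The empirical mean of `f(X₁), …, f(X_N)`. -/
noncomputable def empMean (f : ℝ → ℝ) (x : ℕ → ℝ) (N : ℕ) : ℝ :=
  (1 / (N : ℝ)) * ∑ i ∈ Finset.range N, f (x i)

/-- The empirical standard deviation of `f(X₁), …, f(X_N)`, with normalization `1 / N`. -/
noncomputable def empStd (f : ℝ → ℝ) (x : ℕ → ℝ) (N : ℕ) : ℝ :=
  Real.sqrt ((1 / (N : ℝ)) * ∑ i ∈ Finset.range N, (f (x i) - empMean f x N) ^ 2)

/-- The empirical cross-covariance of `f(X₁), …, f(X_N)` and `g(X₁), …, g(X_N)` with lag `k`,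
with normalization `1 / (N - k)` (meaningful for `k < N`). -/
noncomputable def empCrossCov (k : ℕ) (f g : ℝ → ℝ) (x : ℕ → ℝ) (N : ℕ) : ℝ :=
  (1 / ((N : ℝ) - (k : ℝ))) *
    ∑ i ∈ Finset.range (N - k), (f (x i) - empMean f x N) * (g (x (i + k)) - empMean g x N)

/-- The empirical cross-correlation of `f(X₁), …, f(X_N)` and `g(X₁), …, g(X_N)` with
lag `k`. -/
noncomputable def empCrossCorr (k : ℕ) (f g : ℝ → ℝ) (x : ℕ → ℝ) (N : ℕ) : ℝ :=
  empCrossCov k f g x N / (empStd f x N * empStd g x N)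

/-- The vector of all empirical auto- and cross-correlations of `f₁, …, f_m` with lags
`1, …, K`, in the Euclidean space of dimension `K * (m * m)`. The coordinate `(k, i, j)`
belongs to the lag `k + 1` and the pair `(f i, f j)`. -/
noncomputable def empCorrVector {m : ℕ} (K : ℕ) (f : Fin m → ℝ → ℝ) (x : ℕ → ℝ) (N : ℕ) :
    EuclideanSpace ℝ (Fin K × Fin m × Fin m) :=
  WithLp.toLp 2 fun p => empCrossCorr ((p.1 : ℕ) + 1) (f p.2.1) (f p.2.2) x N

/-! Empirical correlations are invariant under positive affine changes of the functions, so each `f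
i` may be replaced by its standardization `g i`; uncorrelatedness then makes the `g i` centered and
orthonormal in L² of the law of `X`. For such functions, `sqrt_mul_empCrossCorr` writes √N ρ̂
exactly as C_N · (N^(-1/2) ∑ g_i(X_n) g_j(X_{n+k}) + R_N). Here C_N → 1 almost surely by the strong
law and E|R_N| = O(N^(-1/2)), so Slutsky's theorem reduces the claim to the sums of lagged products.

Lagged products with different labels (n, k, i, j) are uncorrelated: if the positions or the lags
differ, some X_l occurs in exactly one factor, which is centered and independent of the rest;
otherwise orthonormality of the `g i` applies. Hence the limit covariance is the identity.

Normality is checked through characteristic functions. A linear combination W_n of lagged products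
depends only on K + 1 consecutive variables. Summing W over blocks of ℓ starting indices separated
by gaps of length K gives i.i.d. block sums, to which the classical central limit theorem applies;
the omitted terms are negligible in L² as ℓ → ∞ (`tendsto_charFun_sum_window`). -/

open scoped Topology

/-! ### Independence and common law of blocks of an i.i.d. sequence -/

section Grouping

variable {Ω ι α : Type*} [MeasurableSpace Ω] [MeasurableSpace α] {μ : Measure Ω}

/-- Disjoint groups of independent random variables are independent. -/
lemma iIndepFun_curry {κ : Type*} [Countable ι] [Countable κ] [IsProbabilityMeasure μ]
    {X : ι × κ → Ω → α} (hX : ∀ p, AEMeasurable (X p) μ) (h : iIndepFun X μ) :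
    iIndepFun (fun i ω j => X (i, j) ω) μ := by
  have hp : ∀ i j, IsProbabilityMeasure (μ.map (X (i, j))) :=
    fun i j => Measure.isProbabilityMeasure_map (hX _)
  have hrow : ∀ i, AEMeasurable (fun ω j => X (i, j) ω) μ :=
    fun i => aemeasurable_pi_lambda _ fun j => hX _
  have h' : iIndepFun (fun (p : (_ : ι) × κ) => X (p.1, p.2)) μ :=
    h.precomp (g := fun p : (_ : ι) × κ => (p.1, p.2)) (Equiv.sigmaEquivProd ι κ).injective
  have hlaw := h'.map_fun_eq_infinitePi_map₀' (fun p => hX _)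
  have hrows : ∀ i, μ.map (fun ω j => X (i, j) ω) =
      Measure.infinitePi (fun j => μ.map (X (i, j))) := fun i =>
    (h.precomp (g := fun j : κ => (i, j)) (Prod.mk_right_injective i)).map_fun_eq_infinitePi_map₀'
      (fun p => hX _)
  rw [iIndepFun_iff_map_fun_eq_infinitePi_map₀' hrow]
  simp_rw [hrows]
  rw [← Measure.infinitePi_map_piCurry (fun i j => μ.map (X (i, j))), ← hlaw,
    AEMeasurable.map_map_of_aemeasurable (by fun_prop) (aemeasurable_pi_lambda _ fun p => hX _)]
  rfl

/-- Consecutive non-overlapping blocks of an i.i.d. sequence are i.i.d. -/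
lemma iIndepFun_blocks [IsProbabilityMeasure μ] {X : ℕ → Ω → α}
    (hX : ∀ n, AEMeasurable (X n) μ) (h : iIndepFun X μ) (L : ℕ) :
    iIndepFun (fun (b : ℕ) ω (j : Fin L) => X (b * L + j) ω) μ := by
  refine iIndepFun_curry (X := fun p : ℕ × Fin L => X (p.1 * L + p.2)) (fun p => hX _)
    (h.precomp (g := fun p : ℕ × Fin L => p.1 * L + (p.2 : ℕ)) ?_)
  rintro ⟨b, j⟩ ⟨c, k⟩ hbc
  have hL : 0 < L := j.pos
  have h1 := congrArg (· / L) hbc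
  have h2 := congrArg (· % L) hbc
  simp only [Nat.mul_add_mod', Nat.mod_eq_of_lt j.2, Nat.mod_eq_of_lt k.2] at h2
  simp only [mul_comm _ L, Nat.mul_add_div hL, Nat.div_eq_of_lt j.2, Nat.div_eq_of_lt k.2] at h1
  ext
  · simpa using h1
  · exact h2

lemma identDistrib_window [IsProbabilityMeasure μ] {X : ℕ → Ω → α} (h : iIndepFun X μ)
    (hident : ∀ n, IdentDistrib (X n) (X 0) μ μ) (L a b : ℕ) :
    IdentDistrib (fun ω (j : Fin L) => X (a + j) ω) (fun ω (j : Fin L) => X (b + j) ω) μ μ := by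
  refine IdentDistrib.pi (X := fun (j : Fin L) => X (a + j)) (Y := fun (j : Fin L) => X (b + j))
    (fun j => (hident _).trans (hident _).symm) ?_ ?_
  · exact h.precomp (g := fun j : Fin L => a + (j : ℕ)) fun i j hij => by
      simpa [Fin.ext_iff] using hij
  · exact h.precomp (g := fun j : Fin L => b + (j : ℕ)) fun i j hij => by
      simpa [Fin.ext_iff] using hij

end Grouping

/-! ### Second moments of orthogonal sums and Cauchy–Schwarz bounds -/

section Orthogonal

variable {Ω : Type*} [MeasurableSpace Ω] {μ : Measure Ω}

lemma integral_sq_sum_of_orthogonal {W : ℕ → Ω → ℝ} {v : ℝ} (hW : ∀ n, MemLp (W n) 2 μ)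
    (hv : ∀ n, ∫ ω, W n ω ^ 2 ∂μ = v) (horth : ∀ n l, n < l → ∫ ω, W n ω * W l ω ∂μ = 0)
    (s : Finset ℕ) : ∫ ω, (∑ n ∈ s, W n ω) ^ 2 ∂μ = s.card * v := by
  have hint : ∀ n l, Integrable (fun ω => W n ω * W l ω) μ := fun n l =>
    (hW n).integrable_mul (hW l)
  have horth' : ∀ n l, n ≠ l → ∫ ω, W n ω * W l ω ∂μ = 0 := fun n l hnl => by
    rcases hnl.lt_or_gt with h | h
    · exact horth n l h
    · simpa only [mul_comm] using horth l n h
  simp_rw [sq, Finset.sum_mul_sum]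
  rw [integral_finsetSum _ fun n _ => integrable_finsetSum _ fun l _ => hint n l]
  simp_rw [integral_finsetSum _ fun l _ => hint _ l]
  rw [Finset.sum_congr rfl fun n hn => Finset.sum_eq_single_of_mem n hn
    fun l _ hl => horth' n l hl.symm]
  simp [← sq, hv]

lemma integral_abs_le_sqrt_integral_sq [IsProbabilityMeasure μ] {Y : Ω → ℝ} (hY : MemLp Y 2 μ) :
    ∫ ω, |Y ω| ∂μ ≤ √(∫ ω, Y ω ^ 2 ∂μ) := by
  refine Real.le_sqrt_of_sq_le ?_
  have h := variance_nonneg (fun ω => |Y ω|) μ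
  rw [variance_eq_sub (by simpa using hY.norm)] at h
  simp only [Pi.pow_apply, sq_abs] at h
  linarith

lemma integral_abs_mul_le {Y Z : Ω → ℝ} (hY : MemLp Y 2 μ) (hZ : MemLp Z 2 μ) :
    ∫ ω, |Y ω * Z ω| ∂μ ≤ √(∫ ω, Y ω ^ 2 ∂μ) * √(∫ ω, Z ω ^ 2 ∂μ) := by
  have := integral_mul_norm_le_Lp_mul_Lq (μ := μ) (f := Y) (g := Z) (p := 2) (q := 2)
    Real.HolderConjugate.two_two (by simpa using hY) (by simpa using hZ)
  simpa [Real.sqrt_eq_rpow, abs_mul] using this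

end Orthogonal

/-! ### Stability of characteristic functions under L¹ perturbation -/

section CharFun

variable {Ω : Type*} [MeasurableSpace Ω] {μ : Measure Ω} [IsProbabilityMeasure μ]

lemma norm_exp_ofReal_mul_I_sub_le (a b : ℝ) :
    ‖Complex.exp (a * Complex.I) - Complex.exp (b * Complex.I)‖ ≤ |a - b| := by
  have h : Complex.exp (a * Complex.I) - Complex.exp (b * Complex.I) =
      Complex.exp (b * Complex.I) * (Complex.exp (Complex.I * ((a - b : ℝ) : ℂ)) - 1) := by
    rw [mul_sub, ← Complex.exp_add, mul_one]
    congr 2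
    push_cast
    ring
  rw [h, norm_mul, Complex.norm_exp_ofReal_mul_I, one_mul]
  exact Real.norm_exp_I_mul_ofReal_sub_one_le

lemma norm_charFun_map_sub_le {A B : Ω → ℝ} (hA : AEMeasurable A μ) (hB : AEMeasurable B μ)
    (hAB : Integrable (fun ω => A ω - B ω) μ) (t : ℝ) :
    ‖charFun (μ.map A) t - charFun (μ.map B) t‖ ≤ |t| * ∫ ω, |A ω - B ω| ∂μ := by
  have hm : ∀ {C : Ω → ℝ}, AEMeasurable C μ →
      Integrable (fun ω => Complex.exp (t * C ω * Complex.I)) μ := fun hC =>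
    Integrable.of_bound (by fun_prop) 1 (ae_of_all _ fun ω => by
      rw [← Complex.ofReal_mul, Complex.norm_exp_ofReal_mul_I])
  rw [charFun_apply_real, charFun_apply_real, integral_map hA (by fun_prop),
    integral_map hB (by fun_prop), ← integral_sub (hm hA) (hm hB), ← integral_const_mul]
  refine norm_integral_le_of_norm_le (hAB.abs.const_mul _) (ae_of_all _ fun ω => ?_)
  have := norm_exp_ofReal_mul_I_sub_le (t * A ω) (t * B ω)
  rw [← mul_sub, abs_mul] at this
  simpa using this

end CharFun

/-! ### Central limit theorem for separated big blocks -/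

section BlockSum

variable {Ω α : Type*} [MeasurableSpace Ω] [MeasurableSpace α] {μ : Measure Ω}
  [IsProbabilityMeasure μ]

lemma tendsto_natDiv_div (L : ℕ) (hL : 0 < L) :
    Tendsto (fun N : ℕ => ((N / L : ℕ) : ℝ) / N) atTop (𝓝 (1 / L)) := by
  have h := (tendsto_nat_floor_mul_div_atTop (R := ℝ) (a := 1 / L) (by positivity)).comp
    tendsto_natCast_atTop_atTop
  refine h.congr fun N => ?_
  simp only [Function.comp_apply]
  rw [one_div_mul_eq_div, Nat.floor_div_natCast, Nat.floor_natCast]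

/-- The big blocks of a sum of functions of `K + 1` consecutive variables satisfy the central
limit theorem. -/
lemma tendsto_charFun_block_sum {X : ℕ → Ω → α} (hindep : iIndepFun X μ)
    (hident : ∀ n, IdentDistrib (X n) (X 0) μ μ) {K : ℕ} {w : (Fin (K + 1) → α) → ℝ}
    (hw : Measurable w) {W : ℕ → Ω → ℝ} (hWw : ∀ n ω, W n ω = w fun i => X (n + i) ω) {v : ℝ}
    (hW : ∀ n, MemLp (W n) 2 μ) (h0 : ∀ n, ∫ ω, W n ω ∂μ = 0)
    (hv : ∀ n, ∫ ω, W n ω ^ 2 ∂μ = v) (horth : ∀ n l, n < l → ∫ ω, W n ω * W l ω ∂μ = 0)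
    {ℓ : ℕ} (hℓ : 0 < ℓ) (t : ℝ) :
    Tendsto (fun N : ℕ => charFun (μ.map fun ω =>
        (√N)⁻¹ * ∑ b ∈ Finset.range (N / (ℓ + K)), ∑ j ∈ Finset.range ℓ, W (b * (ℓ + K) + j) ω) t)
      atTop (𝓝 (Complex.exp (-(t ^ 2 * (v * (ℓ / (ℓ + K))) / 2 : ℝ)))) := by
  have hX : ∀ n, AEMeasurable (X n) μ := fun n => (hident n).aemeasurable_fst
  have hv0 : 0 ≤ v := hv 0 ▸ integral_nonneg fun ω => sq_nonneg _
  set V : ℕ → Ω → ℝ := fun b ω => ∑ j ∈ Finset.range ℓ, W (b * (ℓ + K) + j) ω with hVdef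
  -- The windows starting at the first ℓ positions of a block of length ℓ + K end inside it: this is
  -- what the gap K is for.
  let u : (Fin (ℓ + K) → α) → ℝ := fun x => ∑ j : Fin ℓ, w fun i => x ⟨j + i, by omega⟩
  have hu : Measurable u := by fun_prop
  have hVu : ∀ b, V b = u ∘ fun ω (j : Fin (ℓ + K)) => X (b * (ℓ + K) + j) ω := by
    intro b
    ext ω
    simp only [hVdef, Finset.sum_range, hWw, u, Function.comp_apply, add_assoc]
  have hVindep : iIndepFun V μ := by
    rw [show V = fun b => u ∘ fun ω (j : Fin (ℓ + K)) => X (b * (ℓ + K) + j) ω from funext hVu]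
    exact (iIndepFun_blocks hX hindep (ℓ + K)).comp (fun _ => u) fun _ => hu
  have hVident : ∀ b, IdentDistrib (V b) (V 0) μ μ := fun b => by
    rw [hVu b, hVu 0]
    exact (identDistrib_window hindep hident (ℓ + K) _ _).comp hu
  have hV2 : MemLp (V 0) 2 μ := memLp_finsetSum _ fun j _ => hW _
  have hVmean : ∫ ω, V 0 ω ∂μ = 0 := by
    rw [integral_finsetSum _ fun j _ => (hW _).integrable one_le_two]
    simp [h0]
  have hVvar : Var[V 0; μ] = ℓ * v := by
    rw [variance_of_integral_eq_zero hV2.aemeasurable hVmean]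
    simp only [hVdef, zero_mul, zero_add]
    rw [integral_sq_sum_of_orthogonal hW hv horth, Finset.card_range]
  have hclt := tendstoInDistribution_inv_sqrt_mul_sum_sub (P := μ) (X := V)
    (P' := gaussianReal 0 Var[V 0; μ].toNNReal) (Y := id) ⟨aemeasurable_id, Measure.map_id⟩
    hV2 hVindep hVident
  simp only [hVmean, mul_zero, sub_zero] at hclt
  have hdiv : Tendsto (fun N : ℕ => N / (ℓ + K)) atTop atTop :=
    Nat.tendsto_div_const_atTop (by omega)
  have hclt' : TendstoInDistribution
      (fun (N : ℕ) ω => (√(N / (ℓ + K) : ℕ))⁻¹ * ∑ b ∈ Finset.range (N / (ℓ + K)), V b ω) atTop id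
      (fun _ => μ) (gaussianReal 0 Var[V 0; μ].toNNReal) := by
    exact ⟨fun N => hclt.forall_aemeasurable (N / (ℓ + K)), hclt.aemeasurable_limit,
      hclt.tendsto.comp hdiv⟩
  -- The classical theorem normalizes by the number of blocks; this deterministic factor converts to
  -- normalization by N and turns the variance ℓ v into v ℓ / (ℓ + K).
  have hr : Tendsto (fun N : ℕ => √(((N / (ℓ + K) : ℕ) : ℝ) / N)) atTop
      (𝓝 (√(1 / (ℓ + K : ℕ)))) := by
    exact (tendsto_natDiv_div (ℓ + K) (by omega)).sqrt
  have hsl := hclt'.continuous_comp_prodMk_of_tendstoInMeasure_const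
    (g := fun x : ℝ × ℝ => x.2 * x.1) (by fun_prop)
    (Y := fun (N : ℕ) _ => √(((N / (ℓ + K) : ℕ) : ℝ) / N)) (c := √(1 / (ℓ + K : ℕ)))
    (tendstoInMeasure_of_tendsto_ae (fun _ => by fun_prop) (ae_of_all _ fun _ => hr))
    (fun _ => by fun_prop)
  have hchar := ProbabilityMeasure.tendsto_iff_tendsto_charFun.1 hsl.tendsto t
  simp only [ProbabilityMeasure.coe_mk, id] at hchar
  rw [charFun_map_mul, charFun_gaussianReal, hVvar] at hchar
  convert hchar using 2
  · next N =>
    congr 2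
    ext ω
    rcases Nat.eq_zero_or_pos (N / (ℓ + K)) with h | h
    · simp [h]
    · have h' : √((N / (ℓ + K) : ℕ) : ℝ) ≠ 0 := by positivity
      rw [Real.sqrt_div (by positivity)]
      field_simp
      rfl
  · congr 1
    have hs : √(1 / ((ℓ + K : ℕ) : ℝ)) ^ 2 = 1 / (ℓ + K) := by
      rw [Real.sq_sqrt (by positivity)]
      push_cast
      rfl
    rw [Real.coe_toNNReal _ (by positivity)]
    norm_cast
    rw [mul_pow, hs]
    push_cast
    ring

end BlockSum

/-- An ε/3 argument for the double limit, N → ∞ before l → ∞; here l governs the block length and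
`d` bounds the cost of dropping the gaps. -/
lemma tendsto_of_forall_norm_sub_le {E : Type*} [SeminormedAddCommGroup E] {F : ℕ → E}
    {G : ℕ → ℕ → E} {g : ℕ → E} {a : E} {d : ℕ → ℕ → ℝ} {e : ℕ → ℝ}
    (hG : ∀ l, Tendsto (G l) atTop (𝓝 (g l))) (hg : Tendsto g atTop (𝓝 a))
    (hd : ∀ l, Tendsto (d l) atTop (𝓝 (e l))) (he : Tendsto e atTop (𝓝 0))
    (h : ∀ l N, ‖F N - G l N‖ ≤ d l N) : Tendsto F atTop (𝓝 a) := by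
  rw [Metric.tendsto_nhds]
  intro ε hε
  obtain ⟨l, hl1, hl2⟩ := ((Metric.tendsto_nhds.1 hg (ε / 3) (by positivity)).and
    (he.eventually_lt_const (show 0 < ε / 3 by positivity))).exists
  filter_upwards [Metric.tendsto_nhds.1 (hG l) (ε / 3) (by positivity),
    (hd l).eventually_lt_const hl2] with N hN1 hN2
  have h1 : dist (F N) (G l N) < ε / 3 := by
    rw [dist_eq_norm]
    exact (h l N).trans_lt hN2
  linarith [dist_triangle4 (F N) (G l N) (g l) a]

/-- Division with remainder by ℓ + K makes (b, j) ↦ b(ℓ + K) + j injective. The cardinality is what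
determines the variance of the omitted terms. -/
lemma exists_finset_sum_blocks {ℓ K : ℕ} (hℓ : 0 < ℓ) (N : ℕ) :
    ∃ s ⊆ Finset.range N, s.card = N / (ℓ + K) * ℓ ∧ ∀ W : ℕ → ℝ,
      ∑ b ∈ Finset.range (N / (ℓ + K)), ∑ j ∈ Finset.range ℓ, W (b * (ℓ + K) + j) =
        ∑ n ∈ s, W n := by
  set L := ℓ + K with hL
  have hL0 : 0 < L := by omega
  have hinj : Set.InjOn (fun p : ℕ × ℕ => p.1 * L + p.2)
      (Finset.range (N / L) ×ˢ Finset.range ℓ : Finset (ℕ × ℕ)) := by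
    rintro ⟨b, j⟩ hb ⟨c, k⟩ hc hbc
    simp only [Finset.coe_product, Finset.coe_range, Set.mem_prod, Set.mem_Iio] at hb hc
    have hj : j < L := by omega
    have hk : k < L := by omega
    have h1 := congrArg (· / L) hbc
    have h2 := congrArg (· % L) hbc
    simp only [Nat.mul_add_mod', Nat.mod_eq_of_lt hj, Nat.mod_eq_of_lt hk] at h2
    simp only [mul_comm _ L, Nat.mul_add_div hL0, Nat.div_eq_of_lt hj, Nat.div_eq_of_lt hk] at h1
    simp_all
  refine ⟨(Finset.range (N / L) ×ˢ Finset.range ℓ).image fun p : ℕ × ℕ => p.1 * L + p.2,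
    fun n hn => ?_, ?_, fun W => ?_⟩
  · obtain ⟨⟨b, j⟩, hb, rfl⟩ := Finset.mem_image.1 hn
    simp only [Finset.mem_product, Finset.mem_range] at hb ⊢
    have h1 : (b + 1) * L ≤ N / L * L := Nat.mul_le_mul_right _ hb.1
    have h2 := Nat.div_mul_le_self N L
    rw [add_mul] at h1
    omega
  · rw [Finset.card_image_of_injOn hinj]
    simp
  · rw [Finset.sum_image hinj, Finset.sum_product]

/-! ### Removing the gaps: from big blocks to the full sum -/

section WindowCLT

variable {Ω α : Type*} [MeasurableSpace Ω] [MeasurableSpace α] {μ : Measure Ω}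
  [IsProbabilityMeasure μ]

/-- Central limit theorem, in terms of characteristic functions, for orthogonal centered functions
of `K + 1` consecutive variables of an i.i.d. sequence. -/
theorem tendsto_charFun_sum_window {X : ℕ → Ω → α} (hindep : iIndepFun X μ)
    (hident : ∀ n, IdentDistrib (X n) (X 0) μ μ) {K : ℕ} {w : (Fin (K + 1) → α) → ℝ}
    (hw : Measurable w) {W : ℕ → Ω → ℝ} (hWw : ∀ n ω, W n ω = w fun i => X (n + i) ω) {v : ℝ}
    (hW : ∀ n, MemLp (W n) 2 μ) (h0 : ∀ n, ∫ ω, W n ω ∂μ = 0)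
    (hv : ∀ n, ∫ ω, W n ω ^ 2 ∂μ = v) (horth : ∀ n l, n < l → ∫ ω, W n ω * W l ω ∂μ = 0)
    (t : ℝ) :
    Tendsto (fun N : ℕ => charFun (μ.map fun ω => (√N)⁻¹ * ∑ n ∈ Finset.range N, W n ω) t)
      atTop (𝓝 (Complex.exp (-(t ^ 2 * v / 2 : ℝ)))) := by
  have hlim : Tendsto (fun l : ℕ => ((l + 1 : ℕ) : ℝ) / ((l + 1 : ℕ) + K)) atTop (𝓝 1) :=
    (tendsto_natCast_div_add_atTop (K : ℝ)).comp (tendsto_add_atTop_nat 1)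
  refine tendsto_of_forall_norm_sub_le
    -- Blocks have ℓ = l + 1 > 0 terms. The root bounds the L² norm of the omitted part: N - ⌊N/(ℓ +
    -- K)⌋ ℓ orthogonal terms of second moment v, divided by N.
    (d := fun l N => |t| * √((1 - ((N / (l + 1 + K) : ℕ) : ℝ) / N * (l + 1 : ℕ)) * v))
    (e := fun l => |t| * √((1 - 1 / ((l + 1 + K : ℕ) : ℝ) * (l + 1 : ℕ)) * v))
    (fun l => tendsto_charFun_block_sum hindep hident hw hWw hW h0 hv horth
      (Nat.succ_pos l) t) ?_ ?_ ?_ ?_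
  · have hc : Continuous fun x : ℝ => Complex.exp (-(t ^ 2 * (v * x) / 2 : ℝ)) := by fun_prop
    have := (hc.tendsto 1).comp hlim
    simpa [Function.comp_def] using this
  · intro l
    exact ((((tendsto_natDiv_div (l + 1 + K) (by omega)).mul_const _).const_sub 1).mul_const
      v).sqrt.const_mul _
  · have hc : Continuous fun x : ℝ => |t| * √((1 - x) * v) := by fun_prop
    have := (hc.tendsto 1).comp hlim
    simp only [sub_self, zero_mul, Real.sqrt_zero, mul_zero] at this
    refine this.congr fun l => ?_
    simp only [Function.comp_apply]
    push_cast
    ring_nf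
  · intro l N
    obtain ⟨s, hsN, hcard, hs⟩ := exists_finset_sum_blocks (ℓ := l + 1) (K := K) (by omega) N
    simp_rw [fun ω => hs fun n => W n ω]
    have hL2 : ∀ u : Finset ℕ, MemLp (fun ω => (√N)⁻¹ * ∑ n ∈ u, W n ω) 2 μ := fun u =>
      (memLp_finsetSum _ fun n _ => hW n).const_mul _
    refine (norm_charFun_map_sub_le (hL2 _).aemeasurable (hL2 _).aemeasurable
      (((hL2 _).sub (hL2 _)).integrable one_le_two) t).trans ?_
    refine mul_le_mul_of_nonneg_left ?_ (abs_nonneg t)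
    have hdiff : ∀ ω, (√N)⁻¹ * ∑ n ∈ Finset.range N, W n ω - (√N)⁻¹ * ∑ n ∈ s, W n ω =
        (√N)⁻¹ * ∑ n ∈ Finset.range N \ s, W n ω := fun ω => by
      rw [← Finset.sum_sdiff hsN]
      ring
    simp_rw [hdiff]
    refine (integral_abs_le_sqrt_integral_sq (hL2 _)).trans (Real.sqrt_le_sqrt ?_)
    simp_rw [mul_pow]
    rw [integral_const_mul, integral_sq_sum_of_orthogonal hW hv horth,
      Finset.card_sdiff_of_subset hsN, Nat.cast_sub (Finset.card_le_card hsN), hcard,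
      Finset.card_range, inv_pow, Real.sq_sqrt (by positivity)]
    -- For N = 0 division by zero turns the bound into v, so only v ≥ 0 is needed.
    rcases Nat.eq_zero_or_pos N with rfl | hN
    · have := hv 0 ▸ integral_nonneg (μ := μ) fun ω => sq_nonneg (W 0 ω)
      simpa using this
    · have : (N : ℝ) ≠ 0 := by positivity
      push_cast
      field_simp
      rfl

end WindowCLT

/-! ### Orthogonality and joint limit of lagged products -/

section LaggedProducts

variable {Ω α : Type*} [MeasurableSpace Ω] [MeasurableSpace α] {μ : Measure Ω}
  {X : ℕ → Ω → α}

/-- A centered factor independent of everything else kills the expectation. Stating this for a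
finite index set T allows the remaining indices to coincide with each other. -/
lemma integral_centered_mul_eq_zero (hindep : iIndepFun X μ) (hX : ∀ n, AEMeasurable (X n) μ)
    {n : ℕ} {T : Finset ℕ} (hn : n ∉ T) {g : α → ℝ} (hg : Measurable g)
    (h0 : ∫ ω, g (X n ω) ∂μ = 0) {φ : (T → α) → ℝ} (hφ : Measurable φ) :
    ∫ ω, g (X n ω) * φ (fun i => X i ω) ∂μ = 0 := by
  have h := (hindep.indepFun_finset₀ {n} T (by simpa using hn) hX).comp
    (φ := fun x : (({n} : Finset ℕ) → α) => g (x ⟨n, by simp⟩)) (ψ := φ) (by fun_prop) hφ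
  have hT : AEMeasurable (fun ω (i : T) => X i ω) μ := aemeasurable_pi_lambda _ fun i => hX i
  have := h.integral_fun_mul_eq_mul_integral
    (hg.comp_aemeasurable (hX n)).aestronglyMeasurable
    (hφ.comp_aemeasurable hT).aestronglyMeasurable
  simp only [Function.comp_apply] at this
  rw [this, h0, zero_mul]

/-- Independence factors E[Y²Z²]; without it the product would only be integrable. -/
lemma memLp_two_mul_of_indepFun {Y Z : Ω → ℝ} (h : IndepFun Y Z μ) (hY : MemLp Y 2 μ)
    (hZ : MemLp Z 2 μ) : MemLp (fun ω => Y ω * Z ω) 2 μ := by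
  have hm : AEStronglyMeasurable (fun ω => Y ω * Z ω) μ :=
    hY.aestronglyMeasurable.mul hZ.aestronglyMeasurable
  rw [memLp_two_iff_integrable_sq hm]
  simp_rw [mul_pow]
  exact (h.comp (φ := fun x => x ^ 2) (ψ := fun x => x ^ 2) (by fun_prop)
    (by fun_prop)).integrable_mul hY.integrable_sq hZ.integrable_sq

variable {ι : Type*} [DecidableEq ι]

/-- The functions `g i` are orthonormal and centered under the law of `Y`. -/
structure IsOrthonormalCentered (g : ι → α → ℝ) (Y : Ω → α) (μ : Measure Ω) : Prop where
  measurable : ∀ i, Measurable (g i)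
  memLp : ∀ i, MemLp (fun ω => g i (Y ω)) 2 μ
  integral_eq_zero : ∀ i, ∫ ω, g i (Y ω) ∂μ = 0
  integral_mul : ∀ i j, ∫ ω, g i (Y ω) * g j (Y ω) ∂μ = if i = j then 1 else 0

lemma IsOrthonormalCentered.congr_identDistrib {g : ι → α → ℝ} {Y Z : Ω → α}
    (h : IsOrthonormalCentered g Y μ) (hZ : IdentDistrib Z Y μ μ) :
    IsOrthonormalCentered g Z μ where
  measurable := h.measurable
  memLp i := (hZ.comp (h.measurable i)).memLp_iff.2 (h.memLp i)
  integral_eq_zero i := (hZ.comp (h.measurable i)).integral_eq.trans (h.integral_eq_zero i)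
  integral_mul i j := (hZ.comp ((h.measurable i).mul (h.measurable j))).integral_eq.trans
    (h.integral_mul i j)

variable {g : ι → α → ℝ}

lemma memLp_lagged (hindep : iIndepFun X μ) (hg : ∀ n, IsOrthonormalCentered g (X n) μ) (i j : ι)
    {n l : ℕ} (hnl : n ≠ l) : MemLp (fun ω => g i (X n ω) * g j (X l ω)) 2 μ :=
  memLp_two_mul_of_indepFun ((hindep.indepFun hnl).comp ((hg n).measurable i)
    ((hg n).measurable j)) ((hg n).memLp i) ((hg l).memLp j)

lemma integral_lagged (hindep : iIndepFun X μ) (hX : ∀ n, AEMeasurable (X n) μ)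
    (hg : ∀ n, IsOrthonormalCentered g (X n) μ) (i j : ι)
    {n l : ℕ} (hnl : n ≠ l) : ∫ ω, g i (X n ω) * g j (X l ω) ∂μ = 0 :=
  have hm := (hg 0).measurable
  integral_centered_mul_eq_zero (T := {l}) hindep hX (by simpa using hnl) (hm i)
    ((hg n).integral_eq_zero i) (φ := fun x => g j (x ⟨l, by simp⟩)) (by fun_prop)

/-- The smallest index n occurs only once, even if n + (k + 1) meets l or l + (k' + 1). -/
lemma integral_lagged_mul_lagged_of_lt (hindep : iIndepFun X μ) (hX : ∀ n, AEMeasurable (X n) μ)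
    (hg : ∀ n, IsOrthonormalCentered g (X n) μ) (i j i' j' : ι)
    {n l : ℕ} (hnl : n < l) (k k' : ℕ) :
    ∫ ω, (g i (X n ω) * g j (X (n + (k + 1)) ω)) *
      (g i' (X l ω) * g j' (X (l + (k' + 1)) ω)) ∂μ = 0 := by
  have hm := (hg 0).measurable
  have := integral_centered_mul_eq_zero (n := n) (T := {n + (k + 1), l, l + (k' + 1)}) hindep hX
    (by simp; omega) (hm i) ((hg n).integral_eq_zero i)
    (φ := fun x => g j (x ⟨n + (k + 1), by simp⟩) *
      (g i' (x ⟨l, by simp⟩) * g j' (x ⟨l + (k' + 1), by simp⟩))) (by fun_prop)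
  simpa only [mul_assoc] using this

lemma integral_lagged_mul_lagged (hindep : iIndepFun X μ) (hX : ∀ n, AEMeasurable (X n) μ)
    (hg : ∀ n, IsOrthonormalCentered g (X n) μ) (i j i' j' : ι) (n k k' : ℕ) :
    ∫ ω, (g i (X n ω) * g j (X (n + (k + 1)) ω)) *
      (g i' (X n ω) * g j' (X (n + (k' + 1)) ω)) ∂μ =
      if k = k' ∧ i = i' ∧ j = j' then 1 else 0 := by
  have hm := (hg 0).measurable
  by_cases hk : k = k'
  · subst hk
    have h := ((hindep.indepFun (show n ≠ n + (k + 1) by omega)).comp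
      (φ := fun x => g i x * g i' x) (ψ := fun x => g j x * g j' x)
      (by fun_prop) (by fun_prop)).integral_fun_mul_eq_mul_integral
      (((hg n).memLp i).integrable_mul ((hg n).memLp i')).aestronglyMeasurable
      (((hg _).memLp j).integrable_mul ((hg _).memLp j')).aestronglyMeasurable
    simp only [Function.comp_apply, (hg _).integral_mul] at h
    simp_rw [mul_mul_mul_comm]
    rw [h]
    by_cases hi : i = i' <;> by_cases hj : j = j' <;> simp [hi, hj]
  -- For different lags, the variable at n + (k + 1) occurs only once.
  · have := integral_centered_mul_eq_zero (n := n + (k + 1)) (T := {n, n + (k' + 1)}) hindep hX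
      (by simp; omega) (hm j) ((hg _).integral_eq_zero j)
      (φ := fun x => g i (x ⟨n, by simp⟩) *
        (g i' (x ⟨n, by simp⟩) * g j' (x ⟨n + (k' + 1), by simp⟩))) (by fun_prop)
    rw [if_neg (by tauto), ← this]
    congr with ω
    ring

variable [IsProbabilityMeasure μ] [Fintype ι]

/-- The Cramér–Wold step: the characteristic function of the vector at t is that of the linear
combination with coefficients t at 1. -/
lemma tendsto_charFun_lagged (hindep : iIndepFun X μ)
    (hident : ∀ n, IdentDistrib (X n) (X 0) μ μ) (hg : IsOrthonormalCentered g (X 0) μ) (K : ℕ)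
    (t : Fin K × ι × ι → ℝ) :
    Tendsto (fun N : ℕ => charFun (μ.map fun ω => (√N)⁻¹ * ∑ n ∈ Finset.range N,
      ∑ p, t p * (g p.2.1 (X n ω) * g p.2.2 (X (n + (p.1 + 1)) ω))) 1)
      atTop (𝓝 (Complex.exp (-((∑ p, t p ^ 2) / 2 : ℝ)))) := by
  have hX : ∀ n, AEMeasurable (X n) μ := fun n => (hident n).aemeasurable_fst
  have hg' : ∀ n, IsOrthonormalCentered g (X n) μ := fun n => hg.congr_identDistrib (hident n)
  have hm := hg.measurable
  have hL : ∀ n (p : Fin K × ι × ι), MemLp (fun ω => t p * (g p.2.1 (X n ω) *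
      g p.2.2 (X (n + (p.1 + 1)) ω))) 2 μ := fun n p =>
    (memLp_lagged hindep hg' _ _ (by omega)).const_mul _
  have hLL : ∀ n l (p q : Fin K × ι × ι), Integrable (fun ω => (t p * (g p.2.1 (X n ω) *
      g p.2.2 (X (n + (p.1 + 1)) ω))) * (t q * (g q.2.1 (X l ω) *
      g q.2.2 (X (l + (q.1 + 1)) ω)))) μ := fun n l p q => (hL n p).integrable_mul (hL l q)
  have hprod : ∀ n l, ∫ ω, (∑ p : Fin K × ι × ι, t p * (g p.2.1 (X n ω) *
      g p.2.2 (X (n + (p.1 + 1)) ω))) * (∑ p : Fin K × ι × ι, t p * (g p.2.1 (X l ω) *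
      g p.2.2 (X (l + (p.1 + 1)) ω))) ∂μ = ∑ p : Fin K × ι × ι, ∑ q : Fin K × ι × ι, t p * t q *
      ∫ ω, (g p.2.1 (X n ω) * g p.2.2 (X (n + (p.1 + 1)) ω)) *
        (g q.2.1 (X l ω) * g q.2.2 (X (l + (q.1 + 1)) ω)) ∂μ := fun n l => by
    simp_rw [Finset.sum_mul_sum]
    rw [integral_finsetSum _ fun p _ => integrable_finsetSum _ fun q _ => hLL n l p q]
    refine Finset.sum_congr rfl fun p _ => ?_
    rw [integral_finsetSum _ fun q _ => hLL n l p q]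
    refine Finset.sum_congr rfl fun q _ => ?_
    rw [← integral_const_mul]
    congr with ω
    ring
  have := tendsto_charFun_sum_window (K := K) hindep hident
    (w := fun x => ∑ p : Fin K × ι × ι, t p * (g p.2.1 (x 0) * g p.2.2 (x p.1.succ)))
    (by fun_prop) (W := fun n ω => ∑ p, t p * (g p.2.1 (X n ω) * g p.2.2 (X (n + (p.1 + 1)) ω)))
    (fun n ω => by simp) (v := ∑ p, t p ^ 2) (fun n => memLp_finsetSum _ fun p _ => hL n p)
    (fun n => ?_) (fun n => ?_) (fun n l hnl => ?_) 1
  · simpa using this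
  · rw [integral_finsetSum _ fun p _ => (hL n p).integrable one_le_two]
    refine Finset.sum_eq_zero fun p _ => ?_
    rw [integral_const_mul, integral_lagged hindep hX hg' _ _ (by omega), mul_zero]
  · simp_rw [sq]
    rw [hprod n n]
    refine Finset.sum_congr rfl fun p _ => ?_
    rw [Finset.sum_eq_single_of_mem p (Finset.mem_univ p)]
    · rw [integral_lagged_mul_lagged hindep hX hg']
      simp
    · intro q _ hq
      rw [integral_lagged_mul_lagged hindep hX hg', if_neg, mul_zero]
      rintro ⟨h1, h2, h3⟩
      exact hq (by ext <;> simp_all)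
  · rw [hprod n l]
    simp [integral_lagged_mul_lagged_of_lt hindep hX hg' _ _ _ _ hnl]

/-- Joint central limit theorem for the lagged products of orthonormal centered functions. -/
theorem tendstoInDistribution_lagged (hindep : iIndepFun X μ)
    (hident : ∀ n, IdentDistrib (X n) (X 0) μ μ) (hg : IsOrthonormalCentered g (X 0) μ) (K : ℕ) :
    TendstoInDistribution (fun (N : ℕ) ω => (WithLp.toLp 2 fun p => (√N)⁻¹ *
        ∑ n ∈ Finset.range N, g p.2.1 (X n ω) * g p.2.2 (X (n + (p.1 + 1)) ω) :
        EuclideanSpace ℝ (Fin K × ι × ι)))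
      atTop (id : EuclideanSpace ℝ (Fin K × ι × ι) → EuclideanSpace ℝ (Fin K × ι × ι))
      (fun _ => μ) (multivariateGaussian 0 1) := by
  have hX : ∀ n, AEMeasurable (X n) μ := fun n => (hident n).aemeasurable_fst
  have hm := hg.measurable
  have hmeas : ∀ N : ℕ, AEMeasurable (fun ω => (WithLp.toLp 2 fun p => (√N)⁻¹ *
        ∑ n ∈ Finset.range N, g p.2.1 (X n ω) * g p.2.2 (X (n + (p.1 + 1)) ω) :
        EuclideanSpace ℝ (Fin K × ι × ι))) μ := fun N =>
    (WithLp.measurable_toLp 2 _).comp_aemeasurable (aemeasurable_pi_lambda _ fun p => by fun_prop)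
  refine ⟨hmeas, aemeasurable_id, ProbabilityMeasure.tendsto_iff_tendsto_charFun.2 fun t => ?_⟩
  have h := tendsto_charFun_lagged hindep hident hg K t
  simp only [ProbabilityMeasure.coe_mk, Measure.map_id]
  rw [charFun_multivariateGaussian Matrix.PosSemidef.one]
  convert h using 2
  · next N =>
    rw [charFun_apply, charFun_apply, integral_map (hmeas N) (by fun_prop),
      integral_map (by fun_prop) (by fun_prop)]
    congr with ω
    congr 2
    simp only [PiLp.inner_apply, RCLike.inner_apply, conj_trivial, one_mul, Complex.ofReal_inj]
    simp_rw [Finset.mul_sum]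
    rw [Finset.sum_comm]
    refine Finset.sum_congr rfl fun n _ => Finset.sum_congr rfl fun p _ => ?_
    ring
  · simp [dotProduct, sq]

end LaggedProducts

/-! ### Algebra of the empirical correlations for a fixed data sequence -/

section Deterministic

lemma sub_empMean_affine (f : ℝ → ℝ) (a s : ℝ) (x : ℕ → ℝ) {N : ℕ} (hN : 0 < N) (y : ℝ) :
    (f y - a) / s - empMean (fun z => (f z - a) / s) x N = (f y - empMean f x N) / s := by
  have : (N : ℝ) ≠ 0 := by positivity
  simp only [empMean, ← Finset.sum_div, Finset.sum_sub_distrib, Finset.sum_const,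
    Finset.card_range, nsmul_eq_mul]
  field_simp
  ring

lemma empStd_affine (f : ℝ → ℝ) (a : ℝ) {s : ℝ} (hs : 0 ≤ s) (x : ℕ → ℝ) {N : ℕ} (hN : 0 < N) :
    empStd (fun z => (f z - a) / s) x N = empStd f x N / s := by
  simp only [empStd, sub_empMean_affine f a s x hN, div_pow, ← Finset.sum_div]
  rw [← mul_div_assoc, Real.sqrt_div' _ (sq_nonneg s), Real.sqrt_sq hs]

/-- Empirical cross-correlations do not change under positive affine transformations. -/
lemma empCrossCorr_affine (k : ℕ) (f g : ℝ → ℝ) (a b : ℝ) {s r : ℝ} (hs : 0 < s) (hr : 0 < r)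
    (x : ℕ → ℝ) (N : ℕ) :
    empCrossCorr k (fun z => (f z - a) / s) (fun z => (g z - b) / r) x N =
      empCrossCorr k f g x N := by
  rcases Nat.eq_zero_or_pos N with rfl | hN
  -- Without data the empirical mean is 0 and no longer absorbs the shift, but both correlations are
  -- empty sums.
  · simp [empCrossCorr, empCrossCov]
  · simp only [empCrossCorr, empCrossCov, empStd_affine _ _ hs.le x hN,
      empStd_affine _ _ hr.le x hN, sub_empMean_affine _ _ _ x hN, div_mul_div_comm,
      ← Finset.sum_div]
    rw [← div_div (1 * _), div_div_div_cancel_right₀ (by positivity), div_mul_eq_mul_div]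

/-- The error made when centering is dropped from the rescaled empirical cross-covariance and
all lagged products are summed. -/
noncomputable def lagRemainder (k : ℕ) (f g : ℝ → ℝ) (x : ℕ → ℝ) (N : ℕ) : ℝ :=
  (√N)⁻¹ * (((N - k : ℕ) : ℝ) * ((N : ℝ)⁻¹ * (N : ℝ)⁻¹) *
        ((∑ n ∈ Finset.range N, f (x n)) * ∑ n ∈ Finset.range N, g (x n)) -
      (N : ℝ)⁻¹ * ((∑ n ∈ Finset.range N, f (x n)) * ∑ n ∈ Finset.range (N - k), g (x (n + k))) -
      (N : ℝ)⁻¹ * ((∑ n ∈ Finset.range N, g (x n)) * ∑ n ∈ Finset.range (N - k), f (x n)) -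
      ∑ n ∈ Finset.range N \ Finset.range (N - k), f (x n) * g (x (n + k)))

/-- Expanding the centered products isolates a sum over all n < N, to which the window theorem
applies. It is an exact identity for every N, including N ≤ k, where `Finset.range (N - k)` is
empty. -/
lemma sqrt_mul_empCrossCorr (k : ℕ) (f g : ℝ → ℝ) (x : ℕ → ℝ) (N : ℕ) :
    √N * empCrossCorr k f g x N = (N / ((N : ℝ) - k) / (empStd f x N * empStd g x N)) *
      ((√N)⁻¹ * ∑ n ∈ Finset.range N, f (x n) * g (x (n + k)) + lagRemainder k f g x N) := by
  have hsum : ∑ n ∈ Finset.range N, f (x n) * g (x (n + k)) =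
      ∑ n ∈ Finset.range N \ Finset.range (N - k), f (x n) * g (x (n + k)) +
      ∑ n ∈ Finset.range (N - k), f (x n) * g (x (n + k)) :=
    (Finset.sum_sdiff (Finset.range_subset_range.2 (Nat.sub_le N k))).symm
  have hcov : ∑ i ∈ Finset.range (N - k),
      (f (x i) - empMean f x N) * (g (x (i + k)) - empMean g x N) =
      ∑ n ∈ Finset.range (N - k), f (x n) * g (x (n + k)) -
      empMean f x N * ∑ n ∈ Finset.range (N - k), g (x (n + k)) -
      empMean g x N * ∑ n ∈ Finset.range (N - k), f (x n) +
      ((N - k : ℕ) : ℝ) * (empMean f x N * empMean g x N) := by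
    simp only [sub_mul, mul_sub, Finset.sum_sub_distrib, Finset.sum_const, Finset.card_range,
      nsmul_eq_mul, ← Finset.mul_sum, ← Finset.sum_mul]
    ring
  have hsqrt : √(N : ℝ) = N * (√N)⁻¹ := by
    rw [← div_eq_mul_inv, Real.div_sqrt]
  rw [empCrossCorr, empCrossCov, hcov, hsum, lagRemainder, empMean, empMean]
  nth_rw 1 [hsqrt]
  ring

lemma empStd_eq (f : ℝ → ℝ) (x : ℕ → ℝ) (N : ℕ) :
    empStd f x N = √((∑ i ∈ Finset.range N, f (x i) ^ 2) / N -
      ((∑ i ∈ Finset.range N, f (x i)) / N) ^ 2) := by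
  rcases Nat.eq_zero_or_pos N with rfl | hN
  · simp [empStd]
  · have : (N : ℝ) ≠ 0 := by positivity
    rw [empStd]
    congr 1
    simp only [sub_sq, Finset.sum_add_distrib, Finset.sum_sub_distrib, Finset.sum_const,
      Finset.card_range, nsmul_eq_mul, ← Finset.sum_mul, ← Finset.mul_sum, empMean]
    field_simp
    ring

end Deterministic

/-! ### Negligible remainder, strong law for the normalization, and Slutsky's theorem -/

section Convergence

variable {Ω : Type*} [MeasurableSpace Ω] {μ : Measure Ω}

/-- Union bound over the finitely many coordinates of the sup distance. -/
lemma tendstoInMeasure_pi {P ι : Type*} [Fintype P] {E : Type*} [PseudoEMetricSpace E]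
    {l : Filter ι} {f : ι → Ω → P → E} {g : Ω → P → E}
    (h : ∀ p, TendstoInMeasure μ (fun i ω => f i ω p) l fun ω => g ω p) :
    TendstoInMeasure μ f l g := by
  intro ε hε
  have hsum : Tendsto (fun i => ∑ p, μ {ω | ε ≤ edist (f i ω p) (g ω p)}) l (𝓝 0) := by
    simpa using tendsto_finsetSum Finset.univ fun p _ => h p ε hε
  refine tendsto_of_tendsto_of_tendsto_of_le_of_le tendsto_const_nhds hsum
    (fun _ => zero_le) fun i => ?_
  refine (measure_mono fun ω hω => ?_).trans (measure_iUnion_fintype_le μ _)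
  simpa [edist_pi_def, Finset.le_sup_iff hε] using hω

lemma tendstoInMeasure_zero_of_integral_abs_le {f : ℕ → Ω → ℝ} (hf : ∀ n, Integrable (f n) μ)
    {b : ℕ → ℝ} (hb : Tendsto b atTop (𝓝 0)) (h : ∀ n, ∫ ω, |f n ω| ∂μ ≤ b n) :
    TendstoInMeasure μ f atTop 0 := by
  refine tendstoInMeasure_of_tendsto_eLpNorm one_ne_zero
    (fun n => (hf n).aestronglyMeasurable) aestronglyMeasurable_zero ?_
  have hb' : Tendsto (fun n => ENNReal.ofReal (b n)) atTop (𝓝 0) := by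
    simpa using ENNReal.tendsto_ofReal hb
  refine tendsto_of_tendsto_of_tendsto_of_le_of_le tendsto_const_nhds hb'
    (fun _ => zero_le) fun n => ?_
  rw [sub_zero, eLpNorm_one_eq_lintegral_enorm, ← ofReal_integral_norm_eq_lintegral_enorm (hf n)]
  exact ENNReal.ofReal_le_ofReal (h n)

variable {X : ℕ → Ω → ℝ} {ι : Type*} [DecidableEq ι] {g : ι → ℝ → ℝ}

lemma integral_sq_sum_shift (hindep : iIndepFun X μ)
    (hX : ∀ n, AEMeasurable (X n) μ) (hg : ∀ n, IsOrthonormalCentered g (X n) μ) (i : ι)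
    (k N : ℕ) : ∫ ω, (∑ n ∈ Finset.range N, g i (X (n + k) ω)) ^ 2 ∂μ = N := by
  have := integral_sq_sum_of_orthogonal (W := fun n ω => g i (X (n + k) ω)) (v := 1)
    (fun n => (hg _).memLp i) (fun n => by simpa [sq] using (hg (n + k)).integral_mul i i)
    (fun n l hnl => integral_lagged hindep hX hg i i (by omega)) (Finset.range N)
  simpa using this

lemma integral_abs_lagged_le (hg : ∀ n, IsOrthonormalCentered g (X n) μ) (i j : ι) (n l : ℕ) :
    ∫ ω, |g i (X n ω) * g j (X l ω)| ∂μ ≤ 1 := by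
  refine (integral_abs_mul_le ((hg n).memLp i) ((hg l).memLp j)).trans ?_
  simp [sq, (hg _).integral_mul]

lemma integrable_lagRemainder (hg : ∀ n, IsOrthonormalCentered g (X n) μ) (i j : ι) (k N : ℕ) :
    Integrable (fun ω => lagRemainder k (g i) (g j) (fun n => X n ω) N) μ := by
  have hS : ∀ i k N, MemLp (fun ω => ∑ n ∈ Finset.range N, g i (X (n + k) ω)) 2 μ :=
    fun i k N => memLp_finsetSum _ fun n _ => (hg _).memLp i
  have h1 : Integrable (fun ω => (∑ n ∈ Finset.range N, g i (X n ω)) *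
    ∑ n ∈ Finset.range N, g j (X n ω)) μ := (hS i 0 N).integrable_mul (hS j 0 N)
  have h2 : Integrable (fun ω => (∑ n ∈ Finset.range N, g i (X n ω)) *
    ∑ n ∈ Finset.range (N - k), g j (X (n + k) ω)) μ := (hS i 0 N).integrable_mul (hS j k _)
  have h3 : Integrable (fun ω => (∑ n ∈ Finset.range N, g j (X n ω)) *
    ∑ n ∈ Finset.range (N - k), g i (X n ω)) μ := (hS j 0 N).integrable_mul (hS i 0 _)
  have h4 : Integrable (fun ω => ∑ n ∈ Finset.range N \ Finset.range (N - k),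
    g i (X n ω) * g j (X (n + k) ω)) μ := integrable_finsetSum _ fun n _ =>
      ((hg n).memLp i).integrable_mul ((hg _).memLp j)
  exact ((((h1.const_mul _).sub (h2.const_mul _)).sub (h3.const_mul _)).sub h4).const_mul _

/-- Each of the three products of sums has L¹ norm at most N by Cauchy–Schwarz and orthogonality, so
contributes at most 1 after its factor of at most 1/N. The boundary sum has at most k terms of L¹
norm at most 1; hence k + 3. -/
lemma integral_abs_lagRemainder_le (hindep : iIndepFun X μ)
    (hX : ∀ n, AEMeasurable (X n) μ) (hg : ∀ n, IsOrthonormalCentered g (X n) μ) (i j : ι)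
    (k N : ℕ) :
    ∫ ω, |lagRemainder k (g i) (g j) (fun n => X n ω) N| ∂μ ≤ (√N)⁻¹ * (k + 3) := by
  have hS : ∀ i k N, MemLp (fun ω => ∑ n ∈ Finset.range N, g i (X (n + k) ω)) 2 μ :=
    fun i k N => memLp_finsetSum _ fun n _ => (hg _).memLp i
  have hprod : ∀ i j a b M, M ≤ N → Integrable (fun ω =>
      |(∑ n ∈ Finset.range N, g i (X (n + a) ω)) *
        ∑ n ∈ Finset.range M, g j (X (n + b) ω)|) μ ∧
      ∫ ω, |(∑ n ∈ Finset.range N, g i (X (n + a) ω)) *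
        ∑ n ∈ Finset.range M, g j (X (n + b) ω)| ∂μ ≤ N := fun i j a b M hM => by
    refine ⟨((hS i a N).integrable_mul (hS j b M)).abs,
      (integral_abs_mul_le (hS i a N) (hS j b M)).trans ?_⟩
    rw [integral_sq_sum_shift hindep hX hg, integral_sq_sum_shift hindep hX hg]
    calc √(N : ℝ) * √(M : ℝ) ≤ √N * √N := by gcongr
      _ = N := Real.mul_self_sqrt (by positivity)
  obtain ⟨i1, b1⟩ := hprod i j 0 0 N le_rfl
  obtain ⟨i2, b2⟩ := hprod i j 0 k (N - k) (Nat.sub_le _ _)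
  obtain ⟨i3, b3⟩ := hprod j i 0 0 (N - k) (Nat.sub_le _ _)
  have i4 : ∀ n, Integrable (fun ω => |g i (X n ω) * g j (X (n + k) ω)|) μ := fun n =>
    (((hg n).memLp i).integrable_mul ((hg _).memLp j)).abs
  have i4' := integrable_finsetSum (Finset.range N \ Finset.range (N - k)) fun n _ => i4 n
  have b4 : ∫ ω, ∑ n ∈ Finset.range N \ Finset.range (N - k),
      |g i (X n ω) * g j (X (n + k) ω)| ∂μ ≤ k := by
    rw [integral_finsetSum _ fun n _ => i4 n]
    refine (Finset.sum_le_sum fun n _ => integral_abs_lagged_le hg i j n (n + k)).trans ?_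
    rw [Finset.sum_const, Finset.card_sdiff_of_subset
      (Finset.range_subset_range.2 (Nat.sub_le N k)), Finset.card_range, Finset.card_range,
      nsmul_eq_mul, mul_one, Nat.cast_le]
    omega
  have hN1 : (N : ℝ)⁻¹ * N ≤ 1 := inv_mul_le_one
  have hNk : ((N - k : ℕ) : ℝ) * ((N : ℝ)⁻¹ * (N : ℝ)⁻¹) ≤ (N : ℝ)⁻¹ := by
    have : ((N - k : ℕ) : ℝ) ≤ N := by exact_mod_cast Nat.sub_le N k
    calc ((N - k : ℕ) : ℝ) * ((N : ℝ)⁻¹ * (N : ℝ)⁻¹) ≤ N * ((N : ℝ)⁻¹ * (N : ℝ)⁻¹) := by gcongr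
      _ = ((N : ℝ)⁻¹ * N) * (N : ℝ)⁻¹ := by ring
      _ ≤ 1 * (N : ℝ)⁻¹ := by gcongr
      _ = _ := one_mul _
  simp only [add_zero] at i1 b1 i2 b2 i3 b3
  calc ∫ ω, |lagRemainder k (g i) (g j) (fun n => X n ω) N| ∂μ
      ≤ ∫ ω, (√N)⁻¹ * ((N : ℝ)⁻¹ * |(∑ n ∈ Finset.range N, g i (X n ω)) *
            ∑ n ∈ Finset.range N, g j (X n ω)| +
          (N : ℝ)⁻¹ * |(∑ n ∈ Finset.range N, g i (X n ω)) *
            ∑ n ∈ Finset.range (N - k), g j (X (n + k) ω)| +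
          (N : ℝ)⁻¹ * |(∑ n ∈ Finset.range N, g j (X n ω)) *
            ∑ n ∈ Finset.range (N - k), g i (X n ω)| +
          ∑ n ∈ Finset.range N \ Finset.range (N - k),
            |g i (X n ω) * g j (X (n + k) ω)|) ∂μ := by
        refine integral_mono (integrable_lagRemainder hg i j k N).abs
          (((((i1.const_mul _).add (i2.const_mul _)).add (i3.const_mul _)).add i4').const_mul _)
          fun ω => ?_
        simp only [lagRemainder]
        rw [abs_mul, abs_of_nonneg (show 0 ≤ (√(N : ℝ))⁻¹ by positivity)]
        refine mul_le_mul_of_nonneg_left ?_ (by positivity)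
        refine (abs_sub _ _).trans (add_le_add ((abs_sub _ _).trans (add_le_add
          ((abs_sub _ _).trans (add_le_add ?_ ?_)) ?_)) (Finset.abs_sum_le_sum_abs _ _))
        · rw [abs_mul, abs_of_nonneg (by positivity)]
          exact mul_le_mul_of_nonneg_right hNk (abs_nonneg _)
        · rw [abs_mul, abs_of_nonneg (by positivity)]
        · rw [abs_mul, abs_of_nonneg (by positivity)]
    _ ≤ (√N)⁻¹ * ((N : ℝ)⁻¹ * N + (N : ℝ)⁻¹ * N + (N : ℝ)⁻¹ * N + k) := by
        rw [integral_const_mul, integral_add, integral_add, integral_add, integral_const_mul,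
          integral_const_mul, integral_const_mul]
        · gcongr
        · exact i1.const_mul _
        · exact i2.const_mul _
        · exact (i1.const_mul _).add (i2.const_mul _)
        · exact i3.const_mul _
        · exact ((i1.const_mul _).add (i2.const_mul _)).add (i3.const_mul _)
        · exact i4'
    _ ≤ (√N)⁻¹ * (k + 3) := by
        refine mul_le_mul_of_nonneg_left ?_ (by positivity)
        linarith

variable [IsProbabilityMeasure μ]

/-- The strong law for g and g² gives the limit √(1 - 0²). -/
lemma ae_tendsto_empStd (hindep : iIndepFun X μ)
    (hident : ∀ n, IdentDistrib (X n) (X 0) μ μ) (hg : IsOrthonormalCentered g (X 0) μ) (i : ι) :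
    ∀ᵐ ω ∂μ, Tendsto (fun N => empStd (g i) (fun n => X n ω) N) atTop (𝓝 1) := by
  have hm := hg.measurable i
  have h1 := strong_law_ae_real (fun n ω => g i (X n ω)) ((hg.memLp i).integrable one_le_two)
    (fun n l hnl => (hindep.indepFun hnl).comp hm hm) fun n => (hident n).comp hm
  have h2 := strong_law_ae_real (fun n ω => g i (X n ω) ^ 2) (hg.memLp i).integrable_sq
    (fun n l hnl => (hindep.indepFun hnl).comp (hm.pow_const 2) (hm.pow_const 2))
    fun n => (hident n).comp (hm.pow_const 2)
  have hsq : ∫ ω, g i (X 0 ω) ^ 2 ∂μ = 1 := by simpa [sq] using hg.integral_mul i i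
  filter_upwards [h1, h2] with ω hω1 hω2
  rw [hg.integral_eq_zero] at hω1
  rw [hsq] at hω2
  simp_rw [empStd_eq]
  simpa using (hω2.sub (hω1.pow 2)).sqrt

lemma ae_tendsto_normalization (hindep : iIndepFun X μ)
    (hident : ∀ n, IdentDistrib (X n) (X 0) μ μ) (hg : IsOrthonormalCentered g (X 0) μ)
    (i j : ι) (k : ℕ) :
    ∀ᵐ ω ∂μ, Tendsto (fun N : ℕ => (N : ℝ) / (N - k) /
      (empStd (g i) (fun n => X n ω) N * empStd (g j) (fun n => X n ω) N)) atTop (𝓝 1) := by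
  filter_upwards [ae_tendsto_empStd hindep hident hg i, ae_tendsto_empStd hindep hident hg j]
    with ω hi hj
  have hk : Tendsto (fun N : ℕ => (N : ℝ) / (N - k)) atTop (𝓝 1) := by
    simpa [sub_eq_add_neg] using tendsto_natCast_div_add_atTop (-(k : ℝ))
  have h := hk.div (hi.mul hj) (by simp)
  rw [mul_one, div_one] at h
  exact h

variable [Fintype ι]

/-- The central limit theorem for the empirical correlations of orthonormal centered functions. -/
theorem tendstoInDistribution_empCrossCorr (hindep : iIndepFun X μ)
    (hident : ∀ n, IdentDistrib (X n) (X 0) μ μ) (hg : IsOrthonormalCentered g (X 0) μ) (K : ℕ) :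
    TendstoInDistribution (fun (N : ℕ) ω => (WithLp.toLp 2 fun p =>
        √N * empCrossCorr (p.1 + 1) (g p.2.1) (g p.2.2) (fun n => X n ω) N :
        EuclideanSpace ℝ (Fin K × ι × ι)))
      atTop (id : EuclideanSpace ℝ (Fin K × ι × ι) → EuclideanSpace ℝ (Fin K × ι × ι))
      (fun _ => μ) (multivariateGaussian 0 1) := by
  have hX : ∀ n, AEMeasurable (X n) μ := fun n => (hident n).aemeasurable_fst
  have hg' : ∀ n, IsOrthonormalCentered g (X n) μ := fun n => hg.congr_identDistrib (hident n)
  have hm := hg.measurable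
  have hstd : ∀ i N, AEMeasurable (fun ω => empStd (g i) (fun n => X n ω) N) μ := fun i N => by
    simp only [empStd, empMean]
    fun_prop
  have hR : TendstoInMeasure μ (fun (N : ℕ) ω (p : Fin K × ι × ι) =>
      lagRemainder (p.1 + 1) (g p.2.1) (g p.2.2) (fun n => X n ω) N) atTop fun _ => 0 := by
    refine tendstoInMeasure_pi fun p => tendstoInMeasure_zero_of_integral_abs_le
      (fun N => integrable_lagRemainder hg' _ _ _ _) ?_
      (fun N => integral_abs_lagRemainder_le hindep hX hg' _ _ _ _)
    simpa using (tendsto_inv_atTop_zero.comp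
      (Real.tendsto_sqrt_atTop.comp tendsto_natCast_atTop_atTop)).mul_const _
  have hC : ∀ᵐ ω ∂μ, Tendsto (fun (N : ℕ) (p : Fin K × ι × ι) =>
      (N : ℝ) / (N - (p.1 + 1 : ℕ)) / (empStd (g p.2.1) (fun n => X n ω) N *
        empStd (g p.2.2) (fun n => X n ω) N)) atTop (𝓝 fun _ => 1) := by
    simp_rw [tendsto_pi_nhds]
    exact ae_all_iff.2 fun p => ae_tendsto_normalization hindep hident hg _ _ _
  have hCm : ∀ N : ℕ, AEMeasurable (fun ω (p : Fin K × ι × ι) =>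
      (N : ℝ) / (N - (p.1 + 1 : ℕ)) / (empStd (g p.2.1) (fun n => X n ω) N *
        empStd (g p.2.2) (fun n => X n ω) N)) μ := fun N =>
    aemeasurable_pi_lambda _ fun p => by fun_prop
  -- Slutsky twice: the remainder, tending to 0 in measure, is added, and then each coordinate is
  -- multiplied by its normalization, tending to 1.
  have h1 := (tendstoInDistribution_lagged hindep hident hg K
    ).continuous_comp_prodMk_of_tendstoInMeasure_const
    (g := fun x : EuclideanSpace ℝ (Fin K × ι × ι) × (Fin K × ι × ι → ℝ) =>
      x.1 + WithLp.toLp 2 x.2) (by fun_prop) hR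
    (fun N => aemeasurable_pi_lambda _ fun p => (integrable_lagRemainder hg' _ _ _ _).aemeasurable)
  have h2 := h1.continuous_comp_prodMk_of_tendstoInMeasure_const
    (g := fun x : EuclideanSpace ℝ (Fin K × ι × ι) × (Fin K × ι × ι → ℝ) =>
      WithLp.toLp 2 fun p => x.2 p * x.1 p) (by fun_prop)
    (tendstoInMeasure_of_tendsto_ae (fun N => (hCm N).aestronglyMeasurable) hC) hCm
  convert h2 using 1
  · ext N ω p
    simp [sqrt_mul_empCrossCorr]
  · ext x p
    simp

end Convergence

/-- Standardized uncorrelated functions are orthonormal and centered. -/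
lemma isOrthonormalCentered_standardize {Ω ι : Type*} [MeasurableSpace Ω] [DecidableEq ι]
    {μ : Measure Ω} [IsProbabilityMeasure μ] {Y : Ω → ℝ} (hY : AEMeasurable Y μ)
    {f : ι → ℝ → ℝ} (hf : ∀ i, Measurable (f i)) (hvar : ∀ i, Var[fun ω => f i (Y ω); μ] ≠ 0)
    (hcov : ∀ i j, i ≠ j → cov[fun ω => f i (Y ω), fun ω => f j (Y ω); μ] = 0) :
    IsOrthonormalCentered (fun i z => (f i z - ∫ ω, f i (Y ω) ∂μ) /
      √(Var[fun ω => f i (Y ω); μ])) Y μ := by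
  have hfY : ∀ i, AEMeasurable (fun ω => f i (Y ω)) μ := fun i => (hf i).comp_aemeasurable hY
  have hL : ∀ i, MemLp (fun ω => f i (Y ω)) 2 μ := fun i =>
    -- An infinite extended variance becomes 0 as a real number, so a nonzero variance already
    -- forces square integrability.
    memLp_two_of_variance_ne_zero (hfY i).aestronglyMeasurable (hvar i)
  refine ⟨fun i => by fun_prop, fun i => ?_, fun i => ?_, fun i j => ?_⟩
  · simp_rw [div_eq_mul_inv]
    exact ((hL i).sub (memLp_const _)).mul_const _
  · rw [integral_div, integral_sub ((hL i).integrable one_le_two) (integrable_const _)]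
    simp
  · simp_rw [div_mul_div_comm]
    rw [integral_div]
    change cov[fun ω => f i (Y ω), fun ω => f j (Y ω); μ] / _ = _
    split_ifs with h
    · subst h
      rw [covariance_self (hfY i), Real.mul_self_sqrt (variance_nonneg _ _), div_self (hvar i)]
    · rw [hcov i j h, zero_div]

theorem lemma3 {Ω : Type*} [MeasurableSpace Ω] (μ : Measure Ω) [IsProbabilityMeasure μ]
    (X : ℕ → Ω → ℝ)
    (hindep : iIndepFun X μ)
    (hident : ∀ n, IdentDistrib (X n) (X 0) μ μ)
    (m K : ℕ) (f : Fin m → ℝ → ℝ)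
    (hf : ∀ i, Measurable (f i))
    (hmom : ∀ i, Integrable (fun ω => f i (X 0 ω) ^ 4) μ)
    (hvar : ∀ i, Var[fun ω => f i (X 0 ω); μ] ≠ 0)
    (hcov : ∀ i j, i ≠ j → cov[fun ω => f i (X 0 ω), fun ω => f j (X 0 ω); μ] = 0) :
    TendstoInDistribution
      (fun (N : ℕ) (ω : Ω) => Real.sqrt (N : ℝ) • empCorrVector K f (fun n => X n ω) N)
      atTop
      (id : EuclideanSpace ℝ (Fin K × Fin m × Fin m) →
        EuclideanSpace ℝ (Fin K × Fin m × Fin m))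
      (fun _ => μ)
      (multivariateGaussian 0 (1 : Matrix (Fin K × Fin m × Fin m) (Fin K × Fin m × Fin m) ℝ)) := by
  have hσ : ∀ i, 0 < √(Var[fun ω => f i (X 0 ω); μ]) := fun i =>
    Real.sqrt_pos.2 ((variance_nonneg _ _).lt_of_ne' (hvar i))
  have h := tendstoInDistribution_empCrossCorr hindep hident
    (isOrthonormalCentered_standardize (hident 0).aemeasurable_fst hf hvar hcov) K
  simp only [empCrossCorr_affine _ _ _ _ _ (hσ _) (hσ _)] at h
  exact h
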